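/- Let $(M,g)$ be a smooth four-dimensional Lorentzian manifold of signature $(-,+,+,+)$ with Levi-Civita connection $\nabla$ and Einstein tensor $G_{ab}$, and let $\phi:M\to\mathbb R$ be a smooth function with $\phi>0$ and timelike gradient, i.e. $X:=-\tfrac12\nabla_a\phi\nabla^a\phi>0$ everywhere. Let $\epsilon\in\{1,-1\}$ (in applications the sign for which $u$ is future-directed) and put $$u^a=\epsilon\,\frac{\nabla^a\phi}{\sqrt{2X}},\qquad \Theta=\nabla_au^a,\qquad \dot u^a=u^c\nabla_cu^a,\qquad h_{ab}=g_{ab}+u_au_b,\qquad \Box\phi=g^{ab}\nabla_a\nabla_b\phi .$$ For the viable Horndeski action $S^{(\mathrm g)}=\tfrac12\int d^4x\sqrt{-g}\,[G_4(\phi)R+G_2(\phi,X)-G_3(\phi,X)\Box\phi]$ let $\mathcal E_{ab}=\frac{2}{\sqrt{-g}}\frac{\delta S^{(\mathrm g)}}{\delta g^{ab}}$, explicitly $$\mathcal E_{ab}=G_4G_{ab}-\nabla_a\nabla_bG_4+g_{ab}\Box G_4-\tfrac12G_{2X}\nabla_a\phi\nabla_b\phi-\tfrac12G_2g_{ab}+\tfrac12G_{3X}\Box\phi\,\nabla_a\phi\nabla_b\phi+\nabla_{(a}G_3\nabla_{b)}\phi-\tfrac12g_{ab}\nabla_cG_3\nabla^c\phi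 .$$ For a positive coupling function $f(\phi,X)$ let the effective stress-energy tensor of the $\phi$-fluid be $T^{(f)}_{ab}=\frac1f\big(G_{ab}-\frac1{G_4}\mathcal E_{ab}\big)$, its heat flux density $q^{(f)}_a=-T^{(f)}_{cd}u^ch^d{}_a$, and define the temperature of gravity (multiplied by the thermal conductivity) as $$\mathcal K^{(f)}\mathcal T^{(f)}=\frac1f\,\frac{\epsilon\sqrt{2X}\,(G_{4\phi}-XG_{3X})}{G_4}.$$ Consider the "traditional" scalar-tensor theories $G_4=\phi$, $G_2=\frac{2\omega(\phi)}{\phi}X-V(\phi)$, $G_3=0$, with arbitrary functions $\omega,V$, and take $f=1/\phi$. Then, writing $\mathcal K\mathcal T$ for $\mathcal K^{(f)}\mathcal T^{(f)}$: 1. $\mathcal K\mathcal T=\epsilon\sqrt{2X}$, and it is the coefficient in the Eckart-type law $q^{(f)}_a=-\mathcal K\mathcal T\,\dot u_a$; 2. the temperature of gravity obeys the evolution equation $$\frac{d(\mathcal K\mathcal T)}{d\tau}=-\Theta\,\mathcal K\mathcal T+\Box\phi ,$$ where $\tau$ is the proper time of an observer comoving with the $\phi$-fluid; that is, $u^c\nabla_c(\mathcal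 K\mathcal T)=-\Theta\,\mathcal K\mathcal T+\Box\phi$ on $M$, and the equation holds along every integral curve $\gamma(\tau)$ of $u$. -/

import Mathlib

open scoped Manifold ContDiff
open Bundle

noncomputable section

namespace ScalarTensor

/-- The model space of a four-dimensional manifold. -/
abbrev E4 : Type := EuclideanSpace ℝ (Fin 4)

instance instNormedAddCommGroupBilin : NormedAddCommGroup (E4 →L[ℝ] E4 →L[ℝ] ℝ) :=
  ContinuousLinearMap.toNormedAddCommGroup

instance instNormedSpaceBilin : NormedSpace ℝ (E4 →L[ℝ] E4 →L[ℝ] ℝ) :=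
  ContinuousLinearMap.toNormedSpace

section Geometry

variable {M : Type*} [TopologicalSpace M] [ChartedSpace E4 M]

/-- Product rule for a bilinear form evaluated on two vectors. -/
lemma mvfderiv_clm_apply₂ {B : M → E4 →L[ℝ] E4 →L[ℝ] ℝ} {a b : M → E4} {p : M}
    (hB : MDifferentiableAt (𝓡 4) 𝓘(ℝ, E4 →L[ℝ] E4 →L[ℝ] ℝ) B p)
    (ha : MDifferentiableAt (𝓡 4) 𝓘(ℝ, E4) a p) (hb : MDifferentiableAt (𝓡 4) 𝓘(ℝ, E4) b p)
    (v : TangentSpace (𝓡 4) p) :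
    mvfderiv (𝓡 4) (fun q ↦ B q (a q) (b q)) p v =
      mvfderiv (𝓡 4) B p v (a p) (b p) + B p (mvfderiv (𝓡 4) a p v) (b p)
        + B p (a p) (mvfderiv (𝓡 4) b p v) := by
  have hB' : DifferentiableWithinAt ℝ (B ∘ (extChartAt (𝓡 4) p).symm) (Set.range (𝓡 4))
    (extChartAt (𝓡 4) p p) := hB.differentiableWithinAt_writtenInExtChartAt
  have ha' : DifferentiableWithinAt ℝ (a ∘ (extChartAt (𝓡 4) p).symm) (Set.range (𝓡 4))
    (extChartAt (𝓡 4) p p) := ha.differentiableWithinAt_writtenInExtChartAt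
  have hb' : DifferentiableWithinAt ℝ (b ∘ (extChartAt (𝓡 4) p).symm) (Set.range (𝓡 4))
    (extChartAt (𝓡 4) p p) := hb.differentiableWithinAt_writtenInExtChartAt
  have hc : MDifferentiableAt (𝓡 4) 𝓘(ℝ, ℝ) (fun q ↦ B q (a q) (b q)) p :=
    (hB.clm_apply ha).clm_apply hb
  have eB : mvfderiv (𝓡 4) B p = fderivWithin ℝ (B ∘ (extChartAt (𝓡 4) p).symm)
    (Set.range (𝓡 4)) (extChartAt (𝓡 4) p p) := hB.mvfderiv
  have ea : mvfderiv (𝓡 4) a p = fderivWithin ℝ (a ∘ (extChartAt (𝓡 4) p).symm)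
    (Set.range (𝓡 4)) (extChartAt (𝓡 4) p p) := ha.mvfderiv
  have eb : mvfderiv (𝓡 4) b p = fderivWithin ℝ (b ∘ (extChartAt (𝓡 4) p).symm)
    (Set.range (𝓡 4)) (extChartAt (𝓡 4) p p) := hb.mvfderiv
  have ec : mvfderiv (𝓡 4) (fun q ↦ B q (a q) (b q)) p =
    fderivWithin ℝ (fun y ↦ (B ∘ (extChartAt (𝓡 4) p).symm) y
      ((a ∘ (extChartAt (𝓡 4) p).symm) y) ((b ∘ (extChartAt (𝓡 4) p).symm) y))
      (Set.range (𝓡 4)) (extChartAt (𝓡 4) p p) := hc.mvfderiv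
  rw [eB, ea, eb, ec]
  rw [(𝓡 4).range_eq_univ] at *
  rw [differentiableWithinAt_univ] at hB' ha' hb'
  simp only [fderivWithin_univ]
  have h := (hB'.hasFDerivAt.clm_apply ha'.hasFDerivAt).clm_apply hb'.hasFDerivAt
  rw [h.fderiv]
  have hp : (extChartAt (𝓡 4) p).symm (extChartAt (𝓡 4) p p) = p := extChartAt_to_inv p
  simp only [Function.comp_apply, hp]
  have key : ∀ x y z : ℝ, x + (y + z) = z + y + x := by intros; ring
  exact key _ _ _

lemma isInvertible_of_nondegenerate (B : E4 →L[ℝ] E4 →L[ℝ] ℝ)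
    (h : ∀ a, (∀ b, B a b = 0) → a = 0) : B.IsInvertible := by
  have hinj : Function.Injective (B : E4 →ₗ[ℝ] E4 →L[ℝ] ℝ) := by
    rw [injective_iff_map_eq_zero]
    intro a ha
    exact h a fun b ↦ by
      have := congrArg (fun f : E4 →L[ℝ] ℝ ↦ f b) ha
      simpa using this
  have hrank : Module.finrank ℝ E4 = Module.finrank ℝ (E4 →L[ℝ] ℝ) := by
    rw [← (InnerProductSpace.toDual ℝ E4).toLinearEquiv.finrank_eq]
  refine ⟨((B : E4 →ₗ[ℝ] E4 →L[ℝ] ℝ).linearEquivOfInjective hinj hrank).toContinuousLinearEquiv, ?_⟩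
  ext a b
  rfl

variable [IsManifold (𝓡 4) ∞ M]

variable (M) in
/-- A smooth Lorentzian metric of signature `(-,+,+,+)` on a four-manifold. -/
structure LorentzMetric where
  /-- The bilinear form on each tangent space. -/
  val (p : M) : TangentSpace (𝓡 4) p →L[ℝ] TangentSpace (𝓡 4) p →L[ℝ] ℝ
  symm (p : M) (v w : TangentSpace (𝓡 4) p) : val p v w = val p w v
  /-- Each tangent space has an orthonormal basis with one timelike and three spacelike vectors. -/
  lorentzian (p : M) : ∃ b : Module.Basis (Fin 4) ℝ (TangentSpace (𝓡 4) p),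
    ∀ i j, val p (b i) (b j) = if i = j then (if i = 0 then -1 else 1) else 0
  contMDiff : ContMDiff (𝓡 4) ((𝓡 4).prod 𝓘(ℝ, E4 →L[ℝ] E4 →L[ℝ] ℝ)) ∞
    (fun p ↦ TotalSpace.mk' (E4 →L[ℝ] E4 →L[ℝ] ℝ) p (val p))

/-- A vector field is a section of the tangent bundle (no regularity is imposed here). -/
abbrev VField (M : Type*) [TopologicalSpace M] [ChartedSpace E4 M] : Type _ :=
  Π p : M, TangentSpace (𝓡 4) p

/-- The vector of `T_q M` with given components in the coordinate frame of the preferred chart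
at `p`. -/
def fromFrame (p q : M) : E4 →L[ℝ] TangentSpace (𝓡 4) q :=
  (trivializationAt E4 (TangentSpace (𝓡 4) : M → Type) p).symmL ℝ q

/-- The components of a vector of `T_q M` in the coordinate frame of the preferred chart at `p`. -/
def toFrame (p q : M) : TangentSpace (𝓡 4) q →L[ℝ] E4 :=
  (trivializationAt E4 (TangentSpace (𝓡 4) : M → Type) p).continuousLinearMapAt ℝ q

/-- The components at `q` of a vector field in the coordinate frame of the preferred chart
at `p`. -/
def vcomp (σ : VField M) (p q : M) : E4 := toFrame p q (σ q)

lemma mem_baseSet (p : M) :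
    p ∈ (trivializationAt E4 (TangentSpace (𝓡 4) : M → Type) p).baseSet :=
  FiberBundle.mem_baseSet_trivializationAt' p

lemma eventually_fromFrame_toFrame (p : M) :
    ∀ᶠ q in nhds p, ∀ v, fromFrame p q (toFrame p q v) = v := by
  filter_upwards [(trivializationAt E4 (TangentSpace (𝓡 4) : M → Type) p).open_baseSet.mem_nhds
    (mem_baseSet p)] with q hq v
  exact Trivialization.symmL_continuousLinearMapAt _ hq v

lemma fromFrame_toFrame (p : M) (v : TangentSpace (𝓡 4) p) :
    fromFrame p p (toFrame p p v) = v :=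
  (eventually_fromFrame_toFrame p).self_of_nhds v

lemma toFrame_fromFrame (p : M) (a : E4) : toFrame p p (fromFrame p p a) = a :=
  Trivialization.continuousLinearMapAt_symmL _ (mem_baseSet p) a

lemma mdifferentiableAt_iff_vcomp {σ : VField M} {p : M} :
    MDifferentiableAt (𝓡 4) ((𝓡 4).prod 𝓘(ℝ, E4))
      (fun q ↦ TotalSpace.mk' E4 q (σ q)) p ↔
      MDifferentiableAt (𝓡 4) 𝓘(ℝ, E4) (vcomp σ p) p := by
  rw [mdifferentiableAt_section]
  refine Filter.EventuallyEq.mdifferentiableAt_iff ?_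
  filter_upwards [(trivializationAt E4 (TangentSpace (𝓡 4) : M → Type) p).open_baseSet.mem_nhds
      (mem_baseSet p)] with q hq
  rw [vcomp, toFrame, Trivialization.continuousLinearMapAt_apply,
    Trivialization.linearMapAt_apply, if_pos hq]

namespace LorentzMetric

variable (g : LorentzMetric M)

/-- Index raising: `g.sharp p α` is the vector `v` with `g(v, ·) = α`. -/
def sharp (p : M) : (TangentSpace (𝓡 4) p →L[ℝ] ℝ) →L[ℝ] TangentSpace (𝓡 4) p :=
  (g.val p).inverse

lemma nondegenerate (p : M) (v : TangentSpace (𝓡 4) p) (h : ∀ w, g.val p v w = 0) : v = 0 := by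
  obtain ⟨b, hb⟩ := g.lorentzian p
  apply b.ext_elem
  intro j
  have h1 := h (b j)
  rw [← b.sum_repr v] at h1
  simp only [map_sum, map_smul, FunLike.coe_sum, Finset.sum_apply, smul_apply, hb,
    smul_eq_mul, mul_ite, mul_zero, Finset.sum_ite_eq', Finset.mem_univ, if_true] at h1
  rw [map_zero, Finsupp.zero_apply]
  split_ifs at h1 <;> simpa using h1

lemma isInvertible (p : M) : (g.val p).IsInvertible :=
  isInvertible_of_nondegenerate (g.val p) (g.nondegenerate p)

lemma sharp_val (p : M) (v : TangentSpace (𝓡 4) p) : g.sharp p (g.val p v) = v := by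
  obtain ⟨e, he⟩ := g.isInvertible p
  rw [sharp, ← he, ContinuousLinearMap.inverse_equiv]
  exact e.symm_apply_apply v

lemma val_sharp (p : M) (α : TangentSpace (𝓡 4) p →L[ℝ] ℝ) : g.val p (g.sharp p α) = α := by
  obtain ⟨e, he⟩ := g.isInvertible p
  rw [sharp, ← he, ContinuousLinearMap.inverse_equiv]
  exact e.apply_symm_apply α

/-- The gradient `∇^a ψ` of a function. -/
def grad (ψ : M → ℝ) : VField M := fun p ↦ g.sharp p (mvfderiv (𝓡 4) ψ p)

/-- The components `g_{ij}` of the metric at `q` in the coordinate frame of the preferred chart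
at `p`. -/
def gcomp (p q : M) : E4 →L[ℝ] E4 →L[ℝ] ℝ :=
  ((ContinuousLinearMap.precomp ℝ (fromFrame p q)) ∘L (g.val q)) ∘L (fromFrame p q)

@[simp] lemma gcomp_apply (p q : M) (a b : E4) :
    g.gcomp p q a b = g.val q (fromFrame p q a) (fromFrame p q b) := rfl

/-- The partial derivatives of the metric components at `p`: `g.dgcomp p c a b = ∂_c g_{ab}`. -/
def dgcomp (p : M) : E4 →L[ℝ] E4 →L[ℝ] E4 →L[ℝ] ℝ :=
  mvfderiv (𝓡 4) (g.gcomp p) p ∘L fromFrame p p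

/-- The Christoffel symbols at `p` in the preferred chart at `p`:
`g.christoffel p b a = Γ^c_{ab}` with
`Γ^c_{ab} = ½ g^{cd} (∂_a g_{bd} + ∂_b g_{ad} - ∂_d g_{ba})`. -/
def christoffel (p : M) (b : E4) : E4 →L[ℝ] E4 :=
  (g.gcomp p p).inverse ∘L
    ((1 / 2 : ℝ) • ((g.dgcomp p).flip b + g.dgcomp p b - ((g.dgcomp p).flip b).flip))

lemma christoffel_apply (p : M) (b a : E4) :
    g.christoffel p b a = (g.gcomp p p).inverse ((1 / 2 : ℝ) •
      (g.dgcomp p a b + g.dgcomp p b a - ((g.dgcomp p).flip b).flip a)) := rfl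

lemma christoffel_add (p : M) (b b' : E4) :
    g.christoffel p (b + b') = g.christoffel p b + g.christoffel p b' := by
  refine ContinuousLinearMap.ext fun a ↦ ?_
  rw [add_apply, christoffel_apply, christoffel_apply, christoffel_apply,
    ← map_add, ← smul_add]
  refine congrArg _ (congrArg _ (ContinuousLinearMap.ext fun c ↦ ?_))
  simp only [add_apply, sub_apply,
    ContinuousLinearMap.flip_apply, map_add]
  ring

lemma christoffel_smul (p : M) (r : ℝ) (b : E4) :
    g.christoffel p (r • b) = r • g.christoffel p b := by
  refine ContinuousLinearMap.ext fun a ↦ ?_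
  rw [smul_apply, christoffel_apply, christoffel_apply, ← map_smul,
    smul_comm r]
  refine congrArg _ (congrArg _ (ContinuousLinearMap.ext fun c ↦ ?_))
  simp only [add_apply, sub_apply,
    ContinuousLinearMap.flip_apply, map_smul, smul_apply, smul_eq_mul]
  ring

/-- The Levi-Civita connection `∇` of the metric: at `p`, in the preferred chart at `p`,
`(∇_v σ)^c = ∂_v σ^c + Γ^c_{ab} v^a σ^b`. The value of `∇_v σ` at `p` is
`g.leviCivita σ p v`. -/
def leviCivita : CovariantDerivative (𝓡 4) E4 (TangentSpace (𝓡 4) : M → Type) where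
  toFun σ p := fromFrame p p ∘L
    (mvfderiv (𝓡 4) (vcomp σ p) p + g.christoffel p (vcomp σ p p) ∘L toFrame p p)
  isCovariantDerivativeOnUniv := {
    add := by
      intro σ σ' p hσ hσ' _
      rw [mdifferentiableAt_iff_vcomp] at hσ hσ'
      have h : vcomp (σ + σ') p = vcomp σ p + vcomp σ' p := by
        ext1 q; simp [vcomp]
      rw [h, mvfderiv_add hσ hσ']
      ext1 v
      simp [vcomp, christoffel_add]
      abel
    leibniz := by
      intro σ f p hσ hf _
      rw [mdifferentiableAt_iff_vcomp] at hσ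
      have h : vcomp (f • σ) p = f • vcomp σ p := by
        ext1 q; simp [vcomp]
      rw [h, mvfderiv_smul hf hσ]
      ext1 v
      simp [vcomp, christoffel_smul, fromFrame_toFrame]
      abel }


lemma mdifferentiableAt_gcomp (p : M) :
    MDifferentiableAt (𝓡 4) 𝓘(ℝ, E4 →L[ℝ] E4 →L[ℝ] ℝ) (g.gcomp p) p := by
  have h := (contMDiffAt_hom_bundle _).1 (g.contMDiff p)
  refine MDifferentiableAt.congr_of_eventuallyEq (h.2.mdifferentiableAt (by simp)) ?_
  filter_upwards [(trivializationAt E4 (TangentSpace (𝓡 4) : M → Type) p).open_baseSet.mem_nhds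
    (mem_baseSet p)] with q hq
  ext a b
  have hq' : q ∈ (trivializationAt (E4 →L[ℝ] ℝ)
      (fun q : M ↦ TangentSpace (𝓡 4) q →L[ℝ] ℝ) p).baseSet := by
    rw [hom_trivializationAt_baseSet]
    exact ⟨hq, trivial⟩
  rw [ContinuousLinearMap.inCoordinates, ContinuousLinearMap.comp_apply,
    ContinuousLinearMap.comp_apply, Trivialization.continuousLinearMapAt_apply,
    Trivialization.linearMapAt_apply, if_pos hq', hom_trivializationAt_apply]
  simp [ContinuousLinearMap.inCoordinates, gcomp, fromFrame]

lemma gcomp_inverse (p : M) (α : E4 →L[ℝ] ℝ) : g.gcomp p p ((g.gcomp p p).inverse α) = α := by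
  have : (g.gcomp p p).IsInvertible := by
    refine isInvertible_of_nondegenerate _ fun a h ↦ ?_
    have h1 := g.nondegenerate p (fromFrame p p a) fun w ↦ by
      simpa [fromFrame_toFrame] using h (toFrame p p w)
    rw [← toFrame_fromFrame p a, h1, map_zero]
  obtain ⟨e, he⟩ := this
  rw [← he, ContinuousLinearMap.inverse_equiv]
  exact e.apply_symm_apply α

lemma dgcomp_symm (p : M) (c a b : E4) : g.dgcomp p c a b = g.dgcomp p c b a := by
  have hc (a : E4) : MDifferentiableAt (𝓡 4) 𝓘(ℝ, E4) (fun _ : M ↦ a) p := mdifferentiableAt_const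
  have h (a b : E4) := mvfderiv_clm_apply₂ (g.mdifferentiableAt_gcomp p) (hc a) (hc b)
    (fromFrame p p c)
  have h' (a b : E4) : g.dgcomp p c a b =
      mvfderiv (𝓡 4) (fun q ↦ g.gcomp p q a b) p (fromFrame p p c) := by
    rw [h a b]
    simp [dgcomp, mvfderiv_const]
  rw [h', h']
  congr 2
  ext q
  simp [g.symm q]

/-- The Christoffel symbols with lowered index. -/
lemma gcomp_christoffel (p : M) (b a c : E4) :
    g.gcomp p p (g.christoffel p b a) c =
      (1 / 2 : ℝ) * (g.dgcomp p a b c + g.dgcomp p b a c - g.dgcomp p c b a) := by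
  rw [christoffel_apply, gcomp_inverse]
  simp

/-- The connection is compatible with the metric. -/
theorem leviCivita_metric {σ τ : VField M} {p : M}
    (hσ : MDifferentiableAt (𝓡 4) ((𝓡 4).prod 𝓘(ℝ, E4)) (fun q ↦ TotalSpace.mk' E4 q (σ q)) p)
    (hτ : MDifferentiableAt (𝓡 4) ((𝓡 4).prod 𝓘(ℝ, E4)) (fun q ↦ TotalSpace.mk' E4 q (τ q)) p)
    (v : TangentSpace (𝓡 4) p) :
    mvfderiv (𝓡 4) (fun q ↦ g.val q (σ q) (τ q)) p v =
      g.val p (g.leviCivita σ p v) (τ p) + g.val p (σ p) (g.leviCivita τ p v) := by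
  have h : (fun q ↦ g.val q (σ q) (τ q)) =ᶠ[nhds p]
      fun q ↦ g.gcomp p q (vcomp σ p q) (vcomp τ p q) := by
    filter_upwards [eventually_fromFrame_toFrame p] with q hq
    simp [vcomp, hq]
  have h1 : mvfderiv (𝓡 4) (fun q ↦ g.val q (σ q) (τ q)) p =
      mvfderiv (𝓡 4) (fun q ↦ g.gcomp p q (vcomp σ p q) (vcomp τ p q)) p := by
    unfold mvfderiv
    rw [h.mfderiv_eq, h.self_of_nhds]
  have h2 (ξ : VField M) : g.leviCivita ξ p v = fromFrame p p
    (mvfderiv (𝓡 4) (vcomp ξ p) p v + g.christoffel p (vcomp ξ p p) (toFrame p p v)) := rfl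
  have h3 (ξ : VField M) : ξ p = fromFrame p p (vcomp ξ p p) := by
    rw [vcomp, fromFrame_toFrame]
  have h4 : mvfderiv (𝓡 4) (g.gcomp p) p v = g.dgcomp p (toFrame p p v) := by
    simp [dgcomp, fromFrame_toFrame]
  rw [h1, mvfderiv_clm_apply₂ (g.mdifferentiableAt_gcomp p) (mdifferentiableAt_iff_vcomp.1 hσ)
    (mdifferentiableAt_iff_vcomp.1 hτ), h2, h2, h3 σ, h3 τ, ← gcomp_apply, ← gcomp_apply, h4]
  have h5 (a b : E4) : g.gcomp p p a b = g.gcomp p p b a := by simp [g.symm p]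
  rw [map_add, map_add, add_apply, h5 _ (g.christoffel p _ _), gcomp_christoffel, gcomp_christoffel,
    g.dgcomp_symm p _ (vcomp τ p p), g.dgcomp_symm p (vcomp τ p p), g.dgcomp_symm p (vcomp σ p p)]
  ring

/-- The Lie bracket in the coordinates of the preferred chart. -/
lemma mlieBracket_eq {X Y : VField M} {p : M}
    (hX : MDifferentiableAt (𝓡 4) 𝓘(ℝ, E4) (vcomp X p) p)
    (hY : MDifferentiableAt (𝓡 4) 𝓘(ℝ, E4) (vcomp Y p) p) :
    VectorField.mlieBracket (𝓡 4) X Y p =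
      fromFrame p p (mvfderiv (𝓡 4) (vcomp Y p) p (X p) - mvfderiv (𝓡 4) (vcomp X p) p (Y p)) := by
  have key (X : VField M) : VectorField.mpullbackWithin 𝓘(ℝ, E4) (𝓡 4) (extChartAt (𝓡 4) p).symm X
      (Set.range (𝓡 4)) =ᶠ[nhds (extChartAt (𝓡 4) p p)]
      vcomp X p ∘ (extChartAt (𝓡 4) p).symm := by
    filter_upwards [extChartAt_target_mem_nhds p] with y hy
    have hy' := (extChartAt (𝓡 4) p).map_target hy
    rw [extChartAt_source] at hy'
    rw [VectorField.mpullbackWithin_apply, Function.comp_apply, vcomp, toFrame,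
      TangentBundle.continuousLinearMapAt_trivializationAt hy',
      ContinuousLinearMap.inverse_eq
        (mfderivWithin_extChartAt_symm_comp_mfderiv_extChartAt hy)
        (mfderiv_extChartAt_comp_mfderivWithin_extChartAt_symm hy)]
    rfl
  have hd (X : VField M) (hX : MDifferentiableAt (𝓡 4) 𝓘(ℝ, E4) (vcomp X p) p) :
      mvfderiv (𝓡 4) (vcomp X p) p =
      fderivWithin ℝ (vcomp X p ∘ (extChartAt (𝓡 4) p).symm)
        (Set.range (𝓡 4)) (extChartAt (𝓡 4) p p) := hX.mvfderiv
  have hp : p ∈ (chartAt E4 p).source := mem_chart_source E4 p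
  have hs : fromFrame p p =
      mfderivWithin 𝓘(ℝ, E4) (𝓡 4) (extChartAt (𝓡 4) p).symm (Set.range (𝓡 4))
        (extChartAt (𝓡 4) p p) := TangentBundle.symmL_trivializationAt hp
  have hX0 (X : VField M) : (vcomp X p ∘ (extChartAt (𝓡 4) p).symm) (extChartAt (𝓡 4) p p)
      = X p := by
    rw [Function.comp_apply, extChartAt_to_inv, vcomp, toFrame,
      TangentBundle.continuousLinearMapAt_trivializationAt_eq_core hp]
    exact (tangentBundleCore (𝓡 4) M).coordChange_self (achart E4 p) p hp (X p)
  have hi : (mfderiv (𝓡 4) 𝓘(ℝ, E4) (extChartAt (𝓡 4) p) p).inverse = fromFrame p p := by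
    have h := TangentBundle.continuousLinearMapAt_trivializationAt (I := 𝓡 4) hp
    change (mfderiv (𝓡 4) 𝓘(ℝ, E4) (extChartAt (𝓡 4) p) p :
      TangentSpace (𝓡 4) p →L[ℝ] E4).inverse = _
    rw [show (mfderiv (𝓡 4) 𝓘(ℝ, E4) (extChartAt (𝓡 4) p) p :
      TangentSpace (𝓡 4) p →L[ℝ] E4) = toFrame p p from h.symm]
    apply ContinuousLinearMap.inverse_eq
    · ext1 a
      exact toFrame_fromFrame p a
    · ext1 a
      exact fromFrame_toFrame p a
  rw [hd X hX, hd Y hY, VectorField.mlieBracket, VectorField.mlieBracketWithin_apply]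
  refine (congrArg (fun L : E4 →L[ℝ] TangentSpace (𝓡 4) p ↦ L _) hi).trans ?_
  refine congrArg (fromFrame p p) ?_
  have e (X Y : VField M) : fderivWithin ℝ
      (VectorField.mpullbackWithin 𝓘(ℝ, E4) (𝓡 4) (extChartAt (𝓡 4) p).symm Y (Set.range (𝓡 4)))
      (Set.range (𝓡 4)) (extChartAt (𝓡 4) p p)
      (VectorField.mpullbackWithin 𝓘(ℝ, E4) (𝓡 4) (extChartAt (𝓡 4) p).symm X (Set.range (𝓡 4))
        (extChartAt (𝓡 4) p p)) =
      fderivWithin ℝ (vcomp Y p ∘ (extChartAt (𝓡 4) p).symm)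
        (Set.range (𝓡 4)) (extChartAt (𝓡 4) p p) (X p) := by
    rw [← hX0 X]
    exact congrArg₂ (fun (L : E4 →L[ℝ] E4) (a : E4) ↦ L a) (key Y).fderivWithin_eq_of_nhds
      (key X).self_of_nhds
  rw [Set.preimage_univ, Set.univ_inter]
  exact congrArg₂ (· - ·) (e X Y) (e Y X)

/-- The connection is torsion free. -/
theorem leviCivita_torsion : g.leviCivita.torsion = 0 := by
  rw [CovariantDerivative.torsion_eq_zero_iff]
  intro X Y p hX hY
  rw [mdifferentiableAt_iff_vcomp] at hX hY
  rw [mlieBracket_eq hX hY]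
  have h2 (ξ : VField M) (v : TangentSpace (𝓡 4) p) : g.leviCivita ξ p v = fromFrame p p
    (mvfderiv (𝓡 4) (vcomp ξ p) p v + g.christoffel p (vcomp ξ p p) (toFrame p p v)) := rfl
  rw [h2, h2, ← map_sub]
  congr 1
  have h3 : g.christoffel p (vcomp Y p p) (toFrame p p (X p)) =
      g.christoffel p (vcomp X p p) (toFrame p p (Y p)) := by
    rw [christoffel_apply, christoffel_apply]
    congr 2
    ext c
    simp only [add_apply, sub_apply, ContinuousLinearMap.flip_apply, vcomp]
    rw [g.dgcomp_symm p c]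
    ring
  rw [h3]
  abel

/-! ### Second derivatives and curvature -/

/-- The Hessian `∇_a ∇_b ψ`, evaluated on two vectors. -/
def hess (ψ : M → ℝ) (p : M) (v w : TangentSpace (𝓡 4) p) : ℝ :=
  g.val p (g.leviCivita (g.grad ψ) p v) w

/-- The divergence `∇_a σ^a` of a vector field: the trace of `v ↦ ∇_v σ`. -/
def divergence (σ : VField M) (p : M) : ℝ :=
  LinearMap.trace ℝ (TangentSpace (𝓡 4) p) (g.leviCivita σ p).toLinearMap

/-- The d'Alembertian `□ψ = g^{ab} ∇_a ∇_b ψ`, i.e. the trace of `v ↦ ∇_v grad ψ`. -/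
def box (ψ : M → ℝ) (p : M) : ℝ := g.divergence (g.grad ψ) p

/-- The Riemann tensor `R(v, w) z = ∇_v ∇_w z - ∇_w ∇_v z`, where `v, w, z ∈ T_p M` are extended
near `p` with constant components in the preferred chart at `p` (such fields commute). -/
def riemann (p : M) (v w z : TangentSpace (𝓡 4) p) : TangentSpace (𝓡 4) p :=
  let Z : VField M := fun q ↦ fromFrame p q (toFrame p p z)
  g.leviCivita (fun q ↦ g.leviCivita Z q (fromFrame p q (toFrame p p w))) p v -
    g.leviCivita (fun q ↦ g.leviCivita Z q (fromFrame p q (toFrame p p v))) p w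

/-- The `i`-th coordinate vector of the preferred chart at `p`. -/
def coordVec (p : M) (i : Fin 4) : TangentSpace (𝓡 4) p :=
  fromFrame p p (EuclideanSpace.single i 1)

/-- The `i`-th coordinate covector of the preferred chart at `p`. -/
def coordCovec (p : M) (i : Fin 4) : TangentSpace (𝓡 4) p →L[ℝ] ℝ :=
  (EuclideanSpace.proj i : E4 →L[ℝ] ℝ) ∘L toFrame p p

/-- The Ricci tensor `R_{ab}`: the trace of `v ↦ R(v, w) z`. -/
def ricci (p : M) (w z : TangentSpace (𝓡 4) p) : ℝ :=
  ∑ i, coordCovec p i (g.riemann p (coordVec p i) w z)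

/-- The scalar curvature `R = g^{ab} R_{ab}`. -/
def scalarCurvature (p : M) : ℝ :=
  ∑ i, g.ricci p (coordVec p i) (g.sharp p (coordCovec p i))

/-- The Einstein tensor `G_{ab} = R_{ab} - ½ R g_{ab}`. -/
def einstein (p : M) (v w : TangentSpace (𝓡 4) p) : ℝ :=
  g.ricci p v w - 1 / 2 * g.scalarCurvature p * g.val p v w

/-! ### Kinematics of the scalar-field fluid -/

/-- `X = -½ ∇_a φ ∇^a φ`. The gradient of `φ` is timelike at `p` iff `0 < X`. -/
def kin (φ : M → ℝ) (p : M) : ℝ := -(1 / 2) * mvfderiv (𝓡 4) φ p (g.grad φ p)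

/-- The four-velocity `u^a = ε ∇^a φ / √(2X)` of the `φ`-fluid. -/
def velocity (ε : ℝ) (φ : M → ℝ) : VField M :=
  fun p ↦ (ε / √(2 * g.kin φ p)) • g.grad φ p

/-- The four-velocity is a unit timelike vector, so the parameter of its integral curves is proper
time. -/
lemma velocity_unit {ε : ℝ} (hε : ε = 1 ∨ ε = -1) {φ : M → ℝ} {p : M} (hX : 0 < g.kin φ p) :
    g.val p (g.velocity ε φ p) (g.velocity ε φ p) = -1 := by
  have h1 : g.val p (g.grad φ p) (g.grad φ p) = -(2 * g.kin φ p) := by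
    rw [grad, val_sharp, kin, grad]
    ring
  have h2 : √(2 * g.kin φ p) ^ 2 = 2 * g.kin φ p := Real.sq_sqrt (by positivity)
  have h3 : √(2 * g.kin φ p) ≠ 0 := (Real.sqrt_pos.2 (by positivity)).ne'
  have h4 : ε ^ 2 = 1 := by rcases hε with rfl | rfl <;> norm_num
  simp only [velocity, map_smul, smul_apply, smul_eq_mul, h1]
  field_simp
  rw [h2, h4]
  field_simp

/-- The expansion scalar `Θ = ∇_a u^a`. -/
def expansion (ε : ℝ) (φ : M → ℝ) (p : M) : ℝ := g.divergence (g.velocity ε φ) p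

/-- The four-acceleration `u^c ∇_c u^a`. -/
def acceleration (ε : ℝ) (φ : M → ℝ) : VField M :=
  fun p ↦ g.leviCivita (g.velocity ε φ) p (g.velocity ε φ p)

end LorentzMetric

/-! ### Viable Horndeski gravity -/

/-- The free functions of viable Horndeski gravity, with action
`½ ∫ d⁴x √(-g) [G₄(φ) R + G₂(φ, X) - G₃(φ, X) □φ]`. -/
structure ViableHorndeski where
  /-- The function `G₂(φ, X)`. -/
  G2 : ℝ → ℝ → ℝ
  /-- The function `G₃(φ, X)`. -/
  G3 : ℝ → ℝ → ℝ
  /-- The function `G₄(φ)`. -/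
  G4 : ℝ → ℝ

namespace ViableHorndeski

/-- "Traditional" scalar-tensor theories:
`G₄ = φ`, `G₂ = 2 Ω(φ) X / φ - V(φ)`, `G₃ = 0` (the function usually called lower-case omega is
written `Omega` here). -/
def traditional (Omega V : ℝ → ℝ) : ViableHorndeski where
  G2 := fun s x ↦ 2 * Omega s / s * x - V s
  G3 := fun _ _ ↦ 0
  G4 := fun s ↦ s

variable (S : ViableHorndeski) (g : LorentzMetric M) (φ : M → ℝ)

/-- The tensor `𝓔_{ab} = (2 / √(-g)) δS / δg^{ab}` of the metric field equations `𝓔_{ab} = T_{ab}`,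
i.e. the Euler-Lagrange expression of the action with respect to the inverse metric:
`G₄ G_{ab} - ∇_a ∇_b G₄ + g_{ab} □G₄ - ½ G_{2X} ∇_a φ ∇_b φ - ½ G₂ g_{ab}
  + ½ G_{3X} □φ ∇_a φ ∇_b φ + ∇_{(a} G₃ ∇_{b)} φ - ½ g_{ab} ∇_c G₃ ∇^c φ`. -/
def fieldTensor (p : M) (v w : TangentSpace (𝓡 4) p) : ℝ :=
  let X := g.kin φ
  let G4φ : M → ℝ := fun q ↦ S.G4 (φ q)
  let G3φ : M → ℝ := fun q ↦ S.G3 (φ q) (X q)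
  let dφ := mvfderiv (𝓡 4) φ p
  let dG3 := mvfderiv (𝓡 4) G3φ p
  S.G4 (φ p) * g.einstein p v w - g.hess G4φ p v w + g.val p v w * g.box G4φ p
    - 1 / 2 * deriv (S.G2 (φ p)) (X p) * dφ v * dφ w - 1 / 2 * S.G2 (φ p) (X p) * g.val p v w
    + 1 / 2 * deriv (S.G3 (φ p)) (X p) * g.box φ p * dφ v * dφ w
    + 1 / 2 * (dG3 v * dφ w + dG3 w * dφ v) - 1 / 2 * g.val p v w * dG3 (g.grad φ p)

/-- The effective stress-energy tensor of the `φ`-fluid,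
`T^{(f)}_{ab} = (1/f) (G_{ab} - 𝓔_{ab} / G₄)`. -/
def effectiveStress (f : ℝ → ℝ → ℝ) (p : M) (v w : TangentSpace (𝓡 4) p) : ℝ :=
  1 / f (φ p) (g.kin φ p) * (g.einstein p v w - 1 / S.G4 (φ p) * S.fieldTensor g φ p v w)

/-- The heat flux density `q_a = -T^{(f)}_{cd} u^c h^d_a` of the `φ`-fluid, evaluated on a vector
`w^a`, with `h^d_a w^a = w^d + u^d u_a w^a`. -/
def heatFlux (f : ℝ → ℝ → ℝ) (ε : ℝ) (p : M) (w : TangentSpace (𝓡 4) p) : ℝ :=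
  let u := g.velocity ε φ p;
  -S.effectiveStress g φ f p u (w + g.val p u w • u)

/-- The temperature of gravity (times the thermal conductivity) of the `φ`-fluid,
`𝒦^{(f)} 𝒯^{(f)} = f⁻¹ ε √(2X) (G_{4φ} - X G_{3X}) / G₄`. -/
def gravTemp (f : ℝ → ℝ → ℝ) (ε : ℝ) (p : M) : ℝ :=
  let X := g.kin φ p;
  (f (φ p) X)⁻¹ * (ε * √(2 * X) * (deriv S.G4 (φ p) - X * deriv (S.G3 (φ p)) X) / S.G4 (φ p))

end ViableHorndeski

end Geometry

end ScalarTensor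

end

/-! Everything follows from the factorization ∇φ = s u with s = ε√(2X), valid because ε² = 1. For
these theories G_{4φ} = 1, G_{3X} = 0 and 1/f = G₄ = φ, so 𝒦𝒯 is exactly s. The Leibniz rule gives
∇_v ∇φ = s ∇_v u + ds(v) u (`leviCivita_grad`), and both laws are read off from it.

Evolution: take the trace over v. The rank-one term has trace ds(u), so □φ = sΘ + u(s)
(`mvfderiv_sqrt_kin_velocity`).

Eckart's law: with f = 1/φ one has T = φG - 𝓔. The Einstein tensor cancels, and every term in g_{ab}
or ∇_aφ∇_bφ dies when one slot is u and the other is orthogonal to u, leaving only the Hessian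
(`effectiveStress_traditional`). Putting v = u and projecting off u leaves s times the acceleration
(`hess_velocity`). The projector can then be dropped since the acceleration is orthogonal to u.

No field equation is used. The analytic cost is regularity: the Leibniz rule needs u and s
differentiable, which comes from the coordinate formula g^{ij}∂_jφ and from X > 0. -/

namespace ScalarTensor

variable {M : Type*} [TopologicalSpace M] [ChartedSpace E4 M]

/-! ### Calculus on the manifold and in local frames -/

/-- The solution of an invertible linear system depends differentiably on the system. -/
lemma mdifferentiableAt_inverse_clm_apply {E F : Type*} [NormedAddCommGroup E] [NormedSpace ℝ E]
    [CompleteSpace E] [NormedAddCommGroup F] [NormedSpace ℝ F] {A : M → E →L[ℝ] F} {b : M → F}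
    {p : M} (hA : MDifferentiableAt (𝓡 4) 𝓘(ℝ, E →L[ℝ] F) A p)
    (hb : MDifferentiableAt (𝓡 4) 𝓘(ℝ, F) b p) (hi : (A p).IsInvertible) :
    MDifferentiableAt (𝓡 4) 𝓘(ℝ, E) (fun q ↦ (A q).inverse (b q)) p := by
  -- `inverse` has the junk value 0 off the invertible operators, but these form an open set, so
  -- invertibility at `p` alone suffices.
  have h : ContDiffAt ℝ 1 ContinuousLinearMap.inverse (A p) := hi.contDiffAt_map_inverse
  exact ((h.differentiableAt (by simp)).mdifferentiableAt.comp p hA).clm_apply hb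

/-- The chain rule for a function along an integral curve of a vector field. -/
lemma hasDerivAt_comp_integralCurve {F : M → ℝ} {u : VField M} {γ : ℝ → M} {τ : ℝ}
    (hF : MDifferentiableAt (𝓡 4) 𝓘(ℝ, ℝ) F (γ τ)) (hγ : IsMIntegralCurveAt γ u τ) :
    HasDerivAt (fun t ↦ F (γ t)) (mvfderiv (𝓡 4) F (γ τ) (u (γ τ))) τ := by
  have h : HasFDerivAt (F ∘ γ) ((mvfderiv (𝓡 4) F (γ τ)).comp
      ((1 : ℝ →L[ℝ] ℝ).smulRight (u (γ τ)))) τ :=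
    (hF.hasMFDerivAt.comp τ hγ.self_of_nhds).hasFDerivAt
  have h' := h.hasDerivAt
  rw [ContinuousLinearMap.comp_apply, ContinuousLinearMap.smulRight_apply,
    one_apply_eq_self, one_smul] at h'
  exact h'

variable [IsManifold (𝓡 4) ∞ M]

/-- Near `p`, the frame of the preferred chart at `p` is a frame of the tangent bundle. -/
lemma eventually_toFrame_fromFrame (p : M) :
    ∀ᶠ q in nhds p, ∀ a, toFrame p q (fromFrame p q a) = a := by
  filter_upwards [(trivializationAt E4 (TangentSpace (𝓡 4) : M → Type) p).open_baseSet.mem_nhds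
    (mem_baseSet p)] with q hq a
  exact Trivialization.continuousLinearMapAt_symmL _ hq a

/-- The components of the differential of a smooth function are differentiable. -/
lemma mdifferentiableAt_mvfderiv_comp_fromFrame {ψ : M → ℝ} {p : M}
    (hψ : ContMDiffAt (𝓡 4) 𝓘(ℝ, ℝ) ∞ ψ p) :
    MDifferentiableAt (𝓡 4) 𝓘(ℝ, E4 →L[ℝ] ℝ)
      (fun q ↦ (mvfderiv (𝓡 4) ψ q ∘L fromFrame p q : E4 →L[ℝ] ℝ)) p := by
  have h := (hψ.mfderiv_const (m := 1) (by norm_cast)).mdifferentiableAt (by simp)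
  refine h.congr_of_eventuallyEq (Filter.Eventually.of_forall fun q ↦ ?_)
  ext a
  simp [inTangentCoordinates, ContinuousLinearMap.inCoordinates, fromFrame, mvfderiv]
  rfl

/-! ### Regularity of the gradient and of X -/

namespace LorentzMetric

variable (g : LorentzMetric M)

/-- Near `p` the frame identifies `E4` with the tangent space, so nondegeneracy of `g` passes to its
matrix. A whole neighbourhood is needed in order to differentiate g^{ij}∂_jψ. -/
lemma eventually_isInvertible_gcomp (p : M) : ∀ᶠ q in nhds p, (g.gcomp p q).IsInvertible := by
  filter_upwards [eventually_fromFrame_toFrame p, eventually_toFrame_fromFrame p] with q hq hq'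
  refine isInvertible_of_nondegenerate _ fun a h ↦ ?_
  have h1 := g.nondegenerate q (fromFrame p q a) fun w ↦ by
    simpa [hq] using h (toFrame p q w)
  rw [← hq' a, h1, map_zero]

lemma val_grad (ψ : M → ℝ) (p : M) (v : TangentSpace (𝓡 4) p) :
    g.val p (g.grad ψ p) v = mvfderiv (𝓡 4) ψ p v := by
  rw [grad, val_sharp]

/-- The gradient in coordinates is `g^{ij} ∂_j ψ`. -/
lemma eventually_vcomp_grad (ψ : M → ℝ) (p : M) :
    ∀ᶠ q in nhds p, vcomp (g.grad ψ) p q =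
      (g.gcomp p q).inverse (mvfderiv (𝓡 4) ψ q ∘L fromFrame p q) := by
  filter_upwards [eventually_fromFrame_toFrame p, g.eventually_isInvertible_gcomp p] with q hq hi
  have h : (mvfderiv (𝓡 4) ψ q ∘L fromFrame p q : E4 →L[ℝ] ℝ) =
      g.gcomp p q (vcomp (g.grad ψ) p q) := by
    ext a
    simp [vcomp, hq, val_grad]
  rw [h]
  obtain ⟨e, he⟩ := hi
  rw [← he, ContinuousLinearMap.inverse_equiv]
  exact (e.symm_apply_apply _).symm

lemma mdifferentiableAt_vcomp_grad {ψ : M → ℝ} {p : M}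
    (hψ : ContMDiffAt (𝓡 4) 𝓘(ℝ, ℝ) ∞ ψ p) :
    MDifferentiableAt (𝓡 4) 𝓘(ℝ, E4) (vcomp (g.grad ψ) p) p := by
  refine MDifferentiableAt.congr_of_eventuallyEq ?_ (g.eventually_vcomp_grad ψ p)
  exact mdifferentiableAt_inverse_clm_apply (g.mdifferentiableAt_gcomp p)
    (mdifferentiableAt_mvfderiv_comp_fromFrame hψ)
    (g.eventually_isInvertible_gcomp p).self_of_nhds

/-- `X` is differentiable when `ψ` is smooth. -/
lemma mdifferentiableAt_kin {ψ : M → ℝ} {p : M} (hψ : ContMDiffAt (𝓡 4) 𝓘(ℝ, ℝ) ∞ ψ p) :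
    MDifferentiableAt (𝓡 4) 𝓘(ℝ, ℝ) (g.kin ψ) p := by
  have hN := g.mdifferentiableAt_vcomp_grad hψ
  have h := ((g.mdifferentiableAt_gcomp p).clm_apply hN).clm_apply hN
  -- In the frame at `p`, X = -½ g_{ij} N^i N^j, where N is the gradient.
  refine MDifferentiableAt.congr_of_eventuallyEq (h.const_smul (-(1 / 2) : ℝ)) ?_
  filter_upwards [eventually_fromFrame_toFrame p] with q hq
  simp [kin, vcomp, hq, val_grad]

/-! ### Kinematics of the four-velocity -/

section Velocity

variable {ε : ℝ} {φ : M → ℝ} {p : M}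

lemma mdifferentiableAt_sqrt_kin (hφ : ContMDiffAt (𝓡 4) 𝓘(ℝ, ℝ) ∞ φ p) (hX : 0 < g.kin φ p) :
    MDifferentiableAt (𝓡 4) 𝓘(ℝ, ℝ) (fun q ↦ √(2 * g.kin φ q)) p := by
  have h : DifferentiableAt ℝ (fun x : ℝ ↦ √(2 * x)) (g.kin φ p) :=
    (differentiableAt_id.const_mul 2).sqrt (by positivity)
  exact h.mdifferentiableAt.comp p (g.mdifferentiableAt_kin hφ)

/-- The four-velocity is a differentiable vector field. -/
lemma mdifferentiableAt_velocity (hφ : ContMDiffAt (𝓡 4) 𝓘(ℝ, ℝ) ∞ φ p) (hX : 0 < g.kin φ p) :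
    MDifferentiableAt (𝓡 4) ((𝓡 4).prod 𝓘(ℝ, E4))
      (fun q ↦ TotalSpace.mk' E4 q (g.velocity ε φ q)) p := by
  rw [mdifferentiableAt_iff_vcomp]
  have h : DifferentiableAt ℝ (fun x : ℝ ↦ ε / √(2 * x)) (g.kin φ p) :=
    (differentiableAt_const ε).div ((differentiableAt_id.const_mul 2).sqrt (by positivity))
      (Real.sqrt_pos.2 (by positivity)).ne'
  have h1 : MDifferentiableAt (𝓡 4) 𝓘(ℝ, ℝ) (fun q ↦ ε / √(2 * g.kin φ q)) p :=
    h.mdifferentiableAt.comp p (g.mdifferentiableAt_kin hφ)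
  have h2 := h1.smul (g.mdifferentiableAt_vcomp_grad hφ)
  have e : vcomp (g.velocity ε φ) p = fun q ↦ (ε / √(2 * g.kin φ q)) • vcomp (g.grad φ) p q := by
    ext1 q
    simp [vcomp, velocity]
  rw [e]
  exact h2

/-- The gradient of `φ` is `ε √(2X)` times the four-velocity. -/
lemma grad_eq_smul_velocity (hε : ε = 1 ∨ ε = -1) (hX : 0 < g.kin φ p) :
    g.grad φ p = (ε * √(2 * g.kin φ p)) • g.velocity ε φ p := by
  have h3 : √(2 * g.kin φ p) ≠ 0 := (Real.sqrt_pos.2 (by positivity)).ne'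
  have h4 : ε * √(2 * g.kin φ p) * (ε / √(2 * g.kin φ p)) = 1 := by
    field_simp
    rcases hε with rfl | rfl <;> norm_num
  rw [velocity, smul_smul, h4, one_smul]

/-- The four-acceleration is orthogonal to the four-velocity. -/
lemma val_acceleration_velocity (hε : ε = 1 ∨ ε = -1) (hφ : ContMDiffAt (𝓡 4) 𝓘(ℝ, ℝ) ∞ φ p)
    (hX : ∀ q, 0 < g.kin φ q) :
    g.val p (g.acceleration ε φ p) (g.velocity ε φ p) = 0 := by
  have hu := g.mdifferentiableAt_velocity (ε := ε) hφ (hX p)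
  -- Differentiating g(u,u) = -1 along u gives 0 on one side and 2 g(a,u) on the other, a being the
  -- acceleration.
  have h := g.leviCivita_metric hu hu (g.velocity ε φ p)
  have hc : (fun q ↦ g.val q (g.velocity ε φ q) (g.velocity ε φ q)) = fun _ ↦ (-1 : ℝ) :=
    funext fun q ↦ g.velocity_unit hε (hX q)
  rw [hc, mvfderiv_const, g.symm p (g.velocity ε φ p)] at h
  have h' : (0 : ℝ) = g.val p (g.acceleration ε φ p) (g.velocity ε φ p)
    + g.val p (g.acceleration ε φ p) (g.velocity ε φ p) := h
  linarith

/-- The covariant derivative of the gradient of `φ` in terms of that of the four-velocity. -/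
lemma leviCivita_grad (hε : ε = 1 ∨ ε = -1) (hφ : ContMDiffAt (𝓡 4) 𝓘(ℝ, ℝ) ∞ φ p)
    (hX : ∀ q, 0 < g.kin φ q) :
    g.leviCivita (g.grad φ) p =
      (ε * √(2 * g.kin φ p)) • g.leviCivita (g.velocity ε φ) p +
        (mvfderiv (𝓡 4) (fun q ↦ ε * √(2 * g.kin φ q)) p).smulRight (g.velocity ε φ p) := by
  -- The factorization is an identity of vector fields, which is why X > 0 is assumed at every point
  -- and not only at `p`.
  have h : g.grad φ = (fun q ↦ ε * √(2 * g.kin φ q)) • g.velocity ε φ :=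
    funext fun q ↦ g.grad_eq_smul_velocity hε (hX q)
  rw [h]
  exact g.leviCivita.isCovariantDerivativeOnUniv.leibniz
    (g.mdifferentiableAt_velocity hφ (hX p))
    ((g.mdifferentiableAt_sqrt_kin hφ (hX p)).const_smul ε)

/-- The derivative of `ε √(2X)` along the four-velocity. -/
lemma mvfderiv_sqrt_kin_velocity (hε : ε = 1 ∨ ε = -1) (hφ : ContMDiffAt (𝓡 4) 𝓘(ℝ, ℝ) ∞ φ p)
    (hX : ∀ q, 0 < g.kin φ q) :
    mvfderiv (𝓡 4) (fun q ↦ ε * √(2 * g.kin φ q)) p (g.velocity ε φ p) =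
      -g.expansion ε φ p * (ε * √(2 * g.kin φ p)) + g.box φ p := by
  have h : g.box φ p = (ε * √(2 * g.kin φ p)) * g.expansion ε φ p +
      mvfderiv (𝓡 4) (fun q ↦ ε * √(2 * g.kin φ q)) p (g.velocity ε φ p) := by
    rw [box, divergence, g.leviCivita_grad hε hφ hX, expansion, divergence]
    set L : TangentSpace (𝓡 4) p →L[ℝ] TangentSpace (𝓡 4) p := g.leviCivita (g.velocity ε φ) p
    set α : TangentSpace (𝓡 4) p →L[ℝ] ℝ := mvfderiv (𝓡 4) (fun q ↦ ε * √(2 * g.kin φ q)) p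
    have : FiniteDimensional ℝ (TangentSpace (𝓡 4) p) := inferInstanceAs (FiniteDimensional ℝ E4)
    have e : ((ε * √(2 * g.kin φ p)) • L + α.smulRight (g.velocity ε φ p)).toLinearMap =
      (ε * √(2 * g.kin φ p)) • L.toLinearMap + α.toLinearMap.smulRight (g.velocity ε φ p) := rfl
    -- The trace of v ↦ α(v) u is α(u), here the derivative of ε√(2X) along u.
    rw [e, map_add, map_smul, LinearMap.trace_smulRight]
    rfl
  rw [h]
  ring

/-- `∇_u ∇φ` contracted with a vector orthogonal to `u` is the acceleration times `ε √(2X)`. -/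
lemma hess_velocity (hε : ε = 1 ∨ ε = -1) (hφ : ContMDiffAt (𝓡 4) 𝓘(ℝ, ℝ) ∞ φ p)
    (hX : ∀ q, 0 < g.kin φ q) {w : TangentSpace (𝓡 4) p} (hw : g.val p (g.velocity ε φ p) w = 0) :
    g.hess φ p (g.velocity ε φ p) w =
      ε * √(2 * g.kin φ p) * g.val p (g.acceleration ε φ p) w := by
  rw [hess, g.leviCivita_grad hε hφ hX, acceleration]
  simp [hw]

end Velocity

end LorentzMetric

/-! ### Traditional scalar-tensor theories -/

namespace ViableHorndeski

variable (g : LorentzMetric M) (Omega V : ℝ → ℝ)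

lemma gravTemp_traditional {φ : M → ℝ} {p : M} (hpos : 0 < φ p) (ε : ℝ) :
    (traditional Omega V).gravTemp g φ (fun s _ ↦ 1 / s) ε p = ε * √(2 * g.kin φ p) := by
  simp only [gravTemp, traditional, deriv_const, deriv_id'']
  field_simp
  ring

/-- The effective stress-energy tensor of a traditional scalar-tensor theory on two vectors, the
second of which is orthogonal to the gradient of the scalar field. -/
lemma effectiveStress_traditional {φ : M → ℝ} {p : M} (hpos : 0 < φ p)
    {v w : TangentSpace (𝓡 4) p} (hvw : g.val p v w = 0) (hw : mvfderiv (𝓡 4) φ p w = 0) :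
    (traditional Omega V).effectiveStress g φ (fun s _ ↦ 1 / s) p v w = g.hess φ p v w := by
  -- This kills the ∇G₃ terms; the G_{3X} term goes with the factor dφ(w).
  have h3 : mvfderiv (𝓡 4) (fun _ : M ↦ (0 : ℝ)) p = 0 := mvfderiv_const 0
  simp only [effectiveStress, fieldTensor, traditional, hvw, hw, h3, zero_apply]
  field_simp
  ring

lemma heatFlux_traditional {φ : M → ℝ} {p : M} {ε : ℝ} (hε : ε = 1 ∨ ε = -1)
    (hφ : ContMDiffAt (𝓡 4) 𝓘(ℝ, ℝ) ∞ φ p) (hpos : 0 < φ p) (hX : ∀ q, 0 < g.kin φ q)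
    (w : TangentSpace (𝓡 4) p) :
    (traditional Omega V).heatFlux g φ (fun s _ ↦ 1 / s) ε p w =
      -(ε * √(2 * g.kin φ p)) * g.val p (g.acceleration ε φ p) w := by
  have hu := g.velocity_unit hε (hX p)
  -- The vector is the projection h(w), orthogonal to u because g(u,u) = -1; `hd` follows since ∇φ
  -- is parallel to u.
  have hort : g.val p (g.velocity ε φ p) (w + g.val p (g.velocity ε φ p) w • g.velocity ε φ p)
      = 0 := by
    rw [map_add, map_smul, hu, smul_eq_mul]
    ring
  have hd : mvfderiv (𝓡 4) φ p (w + g.val p (g.velocity ε φ p) w • g.velocity ε φ p) = 0 := by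
    rw [← g.val_grad, g.grad_eq_smul_velocity hε (hX p), map_smul, smul_apply, hort, smul_zero]
  rw [heatFlux, effectiveStress_traditional g Omega V hpos hort hd,
    g.hess_velocity hε hφ hX hort, map_add, map_smul, g.val_acceleration_velocity hε hφ hX,
    smul_zero, add_zero, neg_mul]

end ViableHorndeski

end ScalarTensor

theorem theorem2 {M : Type*} [TopologicalSpace M] [ChartedSpace ScalarTensor.E4 M]
    [IsManifold (𝓡 4) ∞ M]
    -- the spacetime metric
    (g : ScalarTensor.LorentzMetric M)
    -- the functions of the theory, and the positive scalar field with timelike gradient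
    (Omega V : ℝ → ℝ) (φ : M → ℝ) (hφ : ContMDiff (𝓡 4) 𝓘(ℝ, ℝ) ∞ φ)
    (hpos : ∀ p, 0 < φ p) (htimelike : ∀ p, 0 < g.kin φ p)
    -- the sign in the four-velocity
    (ε : ℝ) (hε : ε = 1 ∨ ε = -1) :
    let S := ScalarTensor.ViableHorndeski.traditional Omega V
    let f : ℝ → ℝ → ℝ := fun s _ ↦ 1 / s
    let u := g.velocity ε φ
    let KT := S.gravTemp g φ f ε
    -- the temperature of gravity
    (∀ p, KT p = ε * √(2 * g.kin φ p)) ∧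
    -- it is the coefficient in Eckart's generalized Fourier law
    (∀ p (w : TangentSpace (𝓡 4) p),
      S.heatFlux g φ f ε p w = -KT p * g.val p (g.acceleration ε φ p) w) ∧
    -- evolution equation, as a derivative along the four-velocity
    (∀ p, mvfderiv (𝓡 4) KT p (u p) = -g.expansion ε φ p * KT p + g.box φ p) ∧
    -- evolution equation, in the proper time of a comoving observer
    (∀ (γ : ℝ → M) (τ : ℝ), IsMIntegralCurveAt γ u τ →
      HasDerivAt (fun t ↦ KT (γ t)) (-g.expansion ε φ (γ τ) * KT (γ τ) + g.box φ (γ τ)) τ) := by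
  intro S f u KT
  have hKT : S.gravTemp g φ f ε = fun p ↦ ε * √(2 * g.kin φ p) :=
    funext fun p ↦ ScalarTensor.ViableHorndeski.gravTemp_traditional g Omega V (hpos p) ε
  have hev (p : M) : mvfderiv (𝓡 4) KT p (u p) = -g.expansion ε φ p * KT p + g.box φ p := by
    simp only [KT, hKT]
    exact g.mvfderiv_sqrt_kin_velocity hε (hφ p) htimelike
  refine ⟨fun p ↦ congrFun hKT p, fun p w ↦ ?_, hev, fun γ τ hγ ↦ ?_⟩
  · simp only [KT, hKT]
    exact ScalarTensor.ViableHorndeski.heatFlux_traditional g Omega V hε (hφ p) (hpos p)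
      htimelike w
  · have hF : MDifferentiableAt (𝓡 4) 𝓘(ℝ, ℝ) KT (γ τ) := by
      simp only [KT, hKT]
      exact (g.mdifferentiableAt_sqrt_kin (hφ (γ τ)) (htimelike (γ τ))).const_smul ε
    -- The right-hand side becomes the derivative of 𝒦𝒯 along u, so the chain rule applies.
    rw [← hev]
    exact ScalarTensor.hasDerivAt_comp_integralCurve hF hγ
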